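/- Let $u\in\mathbb{R}$. For $\rho>0$, let $\mathcal{X}$ be a homogeneous Poisson point process on $\mathbb{R}$ with intensity $\rho$, and let $G_H(\mathcal{X})$ be the random connection model with connection function $H(r)=e^{-r^2}$ whose vertices are the points of $\mathcal{X}$ together with one additional vertex (the roadside unit) placed at $u$: given the positions of the points, each unordered pair of distinct vertices at distance $r$ is joined by an edge with probability $H(r)$, independently over pairs. Let $N_2$ be the number of vertices $x\in\mathcal{X}$ for which there is at least one two-hop path $x\leftrightarrow z\leftrightarrow u$ through a vertex $z\in\mathcal{X}$, $z\neq x$, and write $\mathbb{E}[N_2]$ for its mean. Then: (i) For every $\rho>0$, $$\mathbb{E}[N_2]=\rho\int_{-\infty}^{\infty}\Bigl(1-\exp\bigl(-\rho\sqrt{\pi/2}\,e^{-(x-u)^2/2}\bigr)\Bigr)\,dx=\rho\sqrt{2\pi}\sum_{k=1}^{\infty}(-1)^{k-1}\frac{\bigl(\rho\sqrt{\pi/2}\bigr)^k}{k!\,\sqrt{k}},$$ where the integrand is integrable and the series converges. (ii) As $\rho\to\infty$, $$\frac{\mathbb{E}[N_2]}{2\rho\sqrt{2\ln\rho+2\ln\sqrt{\pi/2}}}\longrightarrow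 1,$$ and as $\rho\to0^+$, $$\frac{\mathbb{E}[N_2]}{\pi\rho^2}\longrightarrow 1.$$ -/

import Mathlib

open MeasureTheory ProbabilityTheory Filter Topology
open scoped ENNReal NNReal

/-- The number (possibly infinite) of points of the sequence `X 0, X 1, …` that lie in `B`. -/
noncomputable def pointCount {Ω : Type*} (X : ℕ → Ω → ℝ) (B : Set ℝ) (ω : Ω) : ℕ∞ :=
  {n : ℕ | X n ω ∈ B}.encard

/-- The random points `X 0, X 1, …` (in some measurable enumeration) form a homogeneous Poisson
point process on `ℝ` with intensity `ρ > 0`: the number of points in a Borel set of finite length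
`ℓ` is Poisson distributed with mean `ρ * ℓ`, and the numbers of points in finitely many pairwise
disjoint Borel sets are independent. For `ρ > 0` such a process has infinitely many
points almost surely, so that all of them can be listed along `ℕ`. -/
structure IsPoissonProcess {Ω : Type*} [MeasurableSpace Ω] (P : Measure Ω) (ρ : ℝ)
    (X : ℕ → Ω → ℝ) : Prop where
  measurable : ∀ n, Measurable (X n)
  law : ∀ B : Set ℝ, MeasurableSet B → volume B ≠ ∞ →
    HasLaw (pointCount X B)
      ((poissonMeasure (ρ * volume.real B).toNNReal).map (Nat.cast : ℕ → ℕ∞)) P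
  indep : ∀ (k : ℕ) (B : Fin k → Set ℝ), (∀ i, MeasurableSet (B i)) →
    Pairwise (fun i j => Disjoint (B i) (B j)) →
    iIndepFun (fun i => pointCount X (B i)) P

/-- The Rayleigh fading connection function `H(r) = exp(-r²)`. -/
noncomputable def connectionFunction (r : ℝ) : ℝ := Real.exp (-r ^ 2)

/-- Positions of the vertices: `none` is the roadside unit, at `u`, and `some n` is the `n`-th
point of the configuration `x`. -/
def vertexPosition (u : ℝ) (x : ℕ → ℝ) : Option ℕ → ℝ
  | none => u
  | some n => x n

/-- The probability `H(|a - b|)` of a link between the two endpoints, located at `a` and `b`, of an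
unordered pair of vertices. -/
noncomputable def linkProbability (u : ℝ) (x : ℕ → ℝ) (e : Sym2 (Option ℕ)) : ℝ :=
  Sym2.lift ⟨fun a b => connectionFunction |vertexPosition u x a - vertexPosition u x b|,
    fun _ _ => congrArg connectionFunction (abs_sub_comm _ _)⟩ e

/-- `G` is the random connection model with connection function `H(r) = exp(-r²)` on the Poisson
process `X` of intensity `ρ` on `ℝ`, with a roadside unit added at `u`: conditionally on the
positions of the points, distinct pairs of vertices are linked independently of
each other, and a pair at distance `r` is linked with probability `H(r)`. -/
structure IsRandomConnectionModel {Ω : Type*} [MeasurableSpace Ω] (P : Measure Ω) (ρ u : ℝ)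
    (X : ℕ → Ω → ℝ) (G : Ω → SimpleGraph (Option ℕ)) : Prop where
  poisson : IsPoissonProcess P ρ X
  measurable_link : ∀ a b : Option ℕ, MeasurableSet {ω | (G ω).Adj a b}
  links : ∀ E : Finset (Sym2 (Option ℕ)), (∀ e ∈ E, ¬ e.IsDiag) →
    P⟦{ω | ∀ e ∈ E, e ∈ (G ω).edgeSet} |
        MeasurableSpace.comap (fun ω n => X n ω) (inferInstance : MeasurableSpace (ℕ → ℝ))⟧
      =ᵐ[P] fun ω => ∏ e ∈ E, linkProbability u (fun n => X n ω) e

/-- `N₂`: the number of points of the process that have at least one two-hop path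
`some n ↔ z ↔ none` to the roadside unit. -/
noncomputable def twoHopCount {Ω : Type*} (G : Ω → SimpleGraph (Option ℕ)) (ω : Ω) : ℕ∞ :=
  {n : ℕ | ∃ z : Option ℕ, (G ω).Adj (some n) z ∧ (G ω).Adj z none}.encard

/-- The mean `E[N₂]`. -/
noncomputable def meanTwoHopCount {Ω : Type*} [MeasurableSpace Ω] (P : Measure Ω)
    (G : Ω → SimpleGraph (Option ℕ)) : ℝ≥0∞ :=
  ∫⁻ ω, (twoHopCount G ω : ℝ≥0∞) ∂P

/-! Write φ(x, y) = H(|x - y|) H(|y - u|) for the kernel `hopKernel`. Given the positions, paths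
from a point x to u through distinct relays use disjoint pairs of links, so x has no path with
conditional probability ∏ (1 - φ(x, z)) over the other points z. Averaging the sum over x against
the Poisson process should give ρ ∫ (1 - exp(-ρ ∫ φ(x, y) dy)) dx, and completing the square
evaluates the inner integral as √(π/2) exp(-(x - u)²/2).

The conditional step is `measure_exists_path`: the model prescribes only probabilities that sets of
links are all present, and inclusion-exclusion (`integral_prod_one_sub_congr`) turns these into the
probability of a union of paths.

The averaging step, a case of the Mecke formula, is `lintegral_tsum_neighbourProb`. For a kernel
constant on products of finitely many cells it concerns only independent Poisson counts, and rests
on E[s^N] = exp(-r(1 - s)) and E[N s^(N-1)] = r exp(-r(1 - s)). A continuous kernel is the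
increasing limit of its infima over dyadic cells, and monotone convergence passes to the limit on
both sides.

What remains is the analysis of `gaussianCoverage c` at c = ρ√(π/2): termwise integration gives the
series, and dominated convergence gives both asymptotics, after the rescaling x = √(2 log c) t when
c is large. -/

/-- The integral of `1 - exp (-c exp (-x² / 2))` over the real line. -/
noncomputable def gaussianCoverage (c : ℝ) : ℝ :=
  ∫ x : ℝ, (1 - Real.exp (-(c * Real.exp (-x ^ 2 / 2))))

/-! ### Analysis of the coverage integral: integrability, series, asymptotics. -/

lemma one_sub_exp_neg_nonneg {t : ℝ} (ht : 0 ≤ t) : 0 ≤ 1 - Real.exp (-t) := by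
  have := Real.exp_le_one_iff.2 (neg_nonpos.2 ht)
  linarith

lemma one_sub_exp_neg_le (t : ℝ) : 1 - Real.exp (-t) ≤ t := by
  have := Real.add_one_le_exp (-t)
  linarith

lemma integrable_exp_neg_sq_half : Integrable fun x : ℝ => Real.exp (-x ^ 2 / 2) := by
  have := integrable_exp_neg_mul_sq (b := 1 / 2) (by norm_num)
  refine this.congr (ae_of_all _ fun x => ?_)
  dsimp only
  congr 1
  ring

lemma integrable_gaussianCoverage {c : ℝ} (hc : 0 ≤ c) :
    Integrable fun x : ℝ => 1 - Real.exp (-(c * Real.exp (-x ^ 2 / 2))) := by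
  refine (integrable_exp_neg_sq_half.const_mul c).mono'
    (by fun_prop) (ae_of_all _ fun x => ?_)
  have h : 0 ≤ c * Real.exp (-x ^ 2 / 2) := by positivity
  rw [Real.norm_of_nonneg (one_sub_exp_neg_nonneg h)]
  exact one_sub_exp_neg_le _

lemma gaussianCoverage_nonneg {c : ℝ} (hc : 0 ≤ c) : 0 ≤ gaussianCoverage c :=
  integral_nonneg fun _ => one_sub_exp_neg_nonneg (by positivity)

lemma integral_sub_eq_gaussianCoverage (c u : ℝ) :
    ∫ x : ℝ, (1 - Real.exp (-(c * Real.exp (-(x - u) ^ 2 / 2)))) = gaussianCoverage c :=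
  integral_sub_right_eq_self (fun x : ℝ => 1 - Real.exp (-(c * Real.exp (-x ^ 2 / 2)))) u

lemma integral_exp_neg_sq_half_pow (k : ℕ) :
    ∫ x : ℝ, Real.exp (-x ^ 2 / 2) ^ (k + 1) = √(2 * Real.pi) / √((k + 1 : ℕ) : ℝ) := by
  have h : ∀ x : ℝ, Real.exp (-x ^ 2 / 2) ^ (k + 1)
      = Real.exp (-(((k + 1 : ℕ) : ℝ) / 2) * x ^ 2) := fun x => by
    rw [← Real.exp_nat_mul]
    congr 1
    ring
  simp_rw [h]
  rw [integral_gaussian, ← Real.sqrt_div (by positivity)]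
  congr 1
  field_simp

lemma integrable_exp_neg_sq_half_pow (k : ℕ) :
    Integrable fun x : ℝ => Real.exp (-x ^ 2 / 2) ^ (k + 1) := by
  have h : ∀ x : ℝ, Real.exp (-x ^ 2 / 2) ^ (k + 1)
      = Real.exp (-(((k + 1 : ℕ) : ℝ) / 2) * x ^ 2) := fun x => by
    rw [← Real.exp_nat_mul]
    congr 1
    ring
  simp_rw [h]
  exact integrable_exp_neg_mul_sq (by positivity)

lemma hasSum_one_sub_exp_neg (t : ℝ) :
    HasSum (fun k : ℕ => (-1 : ℝ) ^ k * t ^ (k + 1) / (Nat.factorial (k + 1) : ℝ))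
      (1 - Real.exp (-t)) := by
  have h := NormedSpace.expSeries_div_hasSum_exp (-t)
  rw [← Real.exp_eq_exp_ℝ] at h
  have h2 := ((hasSum_nat_add_iff' 1).2 h).neg
  rw [Finset.sum_range_one, pow_zero, Nat.factorial_zero, Nat.cast_one, div_one, neg_sub] at h2
  convert! h2 using 1
  ext k
  rw [neg_pow t, pow_succ (-1 : ℝ) k]
  ring

lemma hasSum_gaussianCoverage {c : ℝ} (hc : 0 ≤ c) :
    HasSum (fun k : ℕ => √(2 * Real.pi) *
      ((-1 : ℝ) ^ k * c ^ (k + 1) / ((Nat.factorial (k + 1) : ℝ) * √((k + 1 : ℕ) : ℝ))))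
      (gaussianCoverage c) := by
  set F : ℕ → ℝ → ℝ := fun k x =>
    (-1 : ℝ) ^ k * (c * Real.exp (-x ^ 2 / 2)) ^ (k + 1) / (Nat.factorial (k + 1) : ℝ) with hF
  have hF' : ∀ k x, F k x =
      ((-1 : ℝ) ^ k * c ^ (k + 1) / (Nat.factorial (k + 1) : ℝ)) *
        Real.exp (-x ^ 2 / 2) ^ (k + 1) := fun k x => by
    simp only [hF, mul_pow]
    ring
  have hint : ∀ k, Integrable (F k) := fun k => by
    rw [funext (hF' k)]
    exact (integrable_exp_neg_sq_half_pow k).const_mul _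
  have hnorm : ∀ k, ∫ x, ‖F k x‖ =
      (c ^ (k + 1) / (Nat.factorial (k + 1) : ℝ)) * (√(2 * Real.pi) / √((k + 1 : ℕ) : ℝ)) :=
    fun k => by
    rw [← integral_exp_neg_sq_half_pow, ← integral_const_mul]
    congr 1 with x
    rw [hF', norm_mul, norm_div, norm_mul, norm_pow, norm_neg, norm_one, one_pow, one_mul,
      Real.norm_of_nonneg (by positivity), Real.norm_of_nonneg (by positivity),
      Real.norm_of_nonneg (by positivity)]
  -- Since √(k + 1) ≥ 1, the L¹ norms are dominated by the exponential series of c, which permits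
  -- termwise integration.
  have hsum : Summable fun k => ∫ x, ‖F k x‖ := by
    have h1 : Summable fun k : ℕ => c ^ (k + 1) / (Nat.factorial (k + 1) : ℝ) * √(2 * Real.pi) :=
      ((summable_nat_add_iff 1).2 (Real.summable_pow_div_factorial c)).mul_right _
    refine h1.of_nonneg_of_le (fun k => integral_nonneg fun _ => norm_nonneg _) fun k => ?_
    rw [hnorm]
    refine mul_le_mul_of_nonneg_left (div_le_self (by positivity) ?_) (by positivity)
    rw [Real.one_le_sqrt]
    exact_mod_cast Nat.succ_pos k
  have h := hasSum_integral_of_summable_integral_norm hint hsum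
  have htsum : ∫ x, ∑' k, F k x = gaussianCoverage c :=
    integral_congr_ae (ae_of_all _ fun x => (hasSum_one_sub_exp_neg _).tsum_eq)
  rw [htsum] at h
  convert! h using 1
  ext k
  rw [funext (hF' k), integral_const_mul, integral_exp_neg_sq_half_pow]
  field_simp

/-- At x = √(2 log c) t the exponent becomes log c · (1 - t²), so the integrand passes from near 1
to near 0 around |t| = 1, whatever c is. -/
lemma gaussianCoverage_eq_rescaled {c : ℝ} (hc : 1 < c) :
    gaussianCoverage c = √(2 * Real.log c) *
      ∫ t : ℝ, (1 - Real.exp (-(Real.exp (Real.log c * (1 - t ^ 2))))) := by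
  have hlog : 0 < Real.log c := Real.log_pos hc
  have hL : 0 < √(2 * Real.log c) := Real.sqrt_pos.2 (by positivity)
  have h := Measure.integral_comp_mul_left
    (fun x : ℝ => 1 - Real.exp (-(c * Real.exp (-x ^ 2 / 2)))) (√(2 * Real.log c))
  rw [abs_of_pos (inv_pos.2 hL), smul_eq_mul] at h
  rw [gaussianCoverage, ← mul_inv_cancel_left₀ hL.ne' (∫ x : ℝ, (1 - Real.exp _)), ← h]
  congr 2 with t
  congr 3
  nth_rewrite 1 [← Real.exp_log (zero_lt_one.trans hc)]
  rw [← Real.exp_add, mul_pow, Real.sq_sqrt (by positivity)]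
  congr 1
  ring

lemma tendsto_integral_rescaled :
    Tendsto (fun l : ℝ => ∫ t : ℝ, (1 - Real.exp (-(Real.exp (l * (1 - t ^ 2)))))) atTop
      (𝓝 2) := by
  have hlim : ∫ t : ℝ, (Set.Ioo (-1 : ℝ) 1).indicator (fun _ => (1 : ℝ)) t = 2 := by
    rw [integral_indicator measurableSet_Ioo]
    simp
    norm_num
  rw [← hlim]
  -- The dominating function exp(1 - t²) works for l ≥ 1: it is at least 1 when t² ≤ 1, and
  -- otherwise l(1 - t²) ≤ 1 - t². The pointwise limit is the indicator of (-1, 1) away from t = ±1.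
  refine tendsto_integral_filter_of_dominated_convergence
    (fun t : ℝ => Real.exp 1 * Real.exp (-1 * t ^ 2)) ?_ ?_
    ((integrable_exp_neg_mul_sq one_pos).const_mul _) ?_
  · exact Eventually.of_forall fun l => by fun_prop
  · filter_upwards [eventually_ge_atTop (1 : ℝ)] with l hl
    refine ae_of_all _ fun t => ?_
    rw [Real.norm_of_nonneg (one_sub_exp_neg_nonneg (Real.exp_pos _).le), ← Real.exp_add]
    by_cases ht : t ^ 2 ≤ 1
    · calc 1 - Real.exp (-(Real.exp (l * (1 - t ^ 2)))) ≤ 1 := by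
            linarith [Real.exp_pos (-(Real.exp (l * (1 - t ^ 2))))]
        _ ≤ _ := Real.one_le_exp (by linarith)
    · refine (one_sub_exp_neg_le _).trans (Real.exp_le_exp.2 ?_)
      nlinarith
  · have hne : ∀ᵐ t : ℝ, t ≠ 1 ∧ t ≠ -1 :=
      (Measure.ae_ne volume 1).and (Measure.ae_ne volume (-1))
    filter_upwards [hne] with t ht
    by_cases hmem : t ∈ Set.Ioo (-1 : ℝ) 1
    · rw [Set.indicator_of_mem hmem]
      have hpos : 0 < 1 - t ^ 2 := by nlinarith [hmem.1, hmem.2]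
      have h1 : Tendsto (fun l : ℝ => l * (1 - t ^ 2)) atTop atTop :=
        tendsto_id.atTop_mul_const hpos
      have h2 := Real.tendsto_exp_neg_atTop_nhds_zero.comp (Real.tendsto_exp_atTop.comp h1)
      simpa [Function.comp_def] using h2.const_sub 1
    · rw [Set.indicator_of_notMem hmem]
      have hneg : 1 - t ^ 2 < 0 := by
        rcases lt_or_gt_of_ne ht.1 with h | h
        · have : t < -1 := lt_of_le_of_ne (not_lt.1 fun h' => hmem ⟨h', h⟩) ht.2
          nlinarith
        · nlinarith
      have h1 : Tendsto (fun l : ℝ => l * (1 - t ^ 2)) atTop atBot :=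
        tendsto_id.atTop_mul_const_of_neg hneg
      have h2 := (Real.tendsto_exp_atBot.comp h1).neg
      have h3 := ((Real.continuous_exp.tendsto _).comp h2).const_sub 1
      simpa [Function.comp_def] using h3

lemma tendsto_gaussianCoverage_div_atTop :
    Tendsto (fun c : ℝ => gaussianCoverage c / (2 * √(2 * Real.log c))) atTop (𝓝 1) := by
  have h := (tendsto_integral_rescaled.comp Real.tendsto_log_atTop).div_const 2
  rw [div_self two_ne_zero] at h
  refine h.congr' ?_
  filter_upwards [eventually_gt_atTop (1 : ℝ)] with c hc
  have hL : 0 < √(2 * Real.log c) := Real.sqrt_pos.2 (by have := Real.log_pos hc; positivity)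
  rw [gaussianCoverage_eq_rescaled hc, Function.comp_apply,
    mul_comm (2 : ℝ) √_, mul_div_mul_left _ _ hL.ne']

lemma tendsto_gaussianCoverage_div_zero :
    Tendsto (fun c : ℝ => gaussianCoverage c / c) (𝓝[>] 0) (𝓝 √(2 * Real.pi)) := by
  have hint : ∫ x : ℝ, Real.exp (-x ^ 2 / 2) = √(2 * Real.pi) := by
    simpa using integral_exp_neg_sq_half_pow 0
  rw [← hint]
  have : (fun c : ℝ => gaussianCoverage c / c) =
      fun c => ∫ x : ℝ, (1 - Real.exp (-(c * Real.exp (-x ^ 2 / 2)))) / c := by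
    ext c
    rw [gaussianCoverage, integral_div]
  rw [this]
  refine tendsto_integral_filter_of_dominated_convergence (fun x : ℝ => Real.exp (-x ^ 2 / 2))
    ?_ ?_ integrable_exp_neg_sq_half ?_
  · exact Eventually.of_forall fun l => by fun_prop
  · filter_upwards [self_mem_nhdsWithin] with c (hc : 0 < c)
    refine ae_of_all _ fun x => ?_
    have h : 0 ≤ c * Real.exp (-x ^ 2 / 2) := by positivity
    rw [Real.norm_of_nonneg (div_nonneg (one_sub_exp_neg_nonneg h) hc.le), div_le_iff₀ hc,
      mul_comm]
    exact one_sub_exp_neg_le _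
  · refine ae_of_all _ fun x => ?_
    set g := Real.exp (-x ^ 2 / 2)
    -- The pointwise limit of the quotient by c is a derivative at c = 0.
    have hd : HasDerivAt (fun c : ℝ => 1 - Real.exp (-(c * g))) g 0 := by
      have := ((((hasDerivAt_id (0 : ℝ)).mul_const g).neg).exp).const_sub 1
      simpa using this
    have hs := (hasDerivAt_iff_tendsto_slope.1 hd).mono_left
      (nhdsWithin_mono (0 : ℝ) (fun c (hc : 0 < c) => hc.ne'))
    refine hs.congr fun c => ?_
    simp [slope_def_field]

/-! ### Measurability of counts and Poisson moment identities. -/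

/-- As an extended real the cardinality is a countable sum of indicators; since ℕ∞ is countable, it
is enough to pull singletons back. -/
lemma measurable_encard_setOf {Ω : Type*} [MeasurableSpace Ω] {p : ℕ → Ω → Prop}
    (hp : ∀ n, MeasurableSet {ω | p n ω}) :
    Measurable fun ω => {n : ℕ | p n ω}.encard := by
  have h : Measurable fun ω => (({n : ℕ | p n ω}.encard : ℕ∞) : ℝ≥0∞) := by
    have : (fun ω => (({n : ℕ | p n ω}.encard : ℕ∞) : ℝ≥0∞)) =
        fun ω => ∑' n, {ω | p n ω}.indicator (fun _ => (1 : ℝ≥0∞)) ω := by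
      ext ω
      rw [← ENNReal.tsum_set_one, tsum_subtype {n : ℕ | p n ω} fun _ => (1 : ℝ≥0∞)]
      rfl
    rw [this]
    exact Measurable.tsum fun n => measurable_const.indicator (hp n)
  refine measurable_to_countable' fun k => ?_
  have hk : (fun ω => {n : ℕ | p n ω}.encard) ⁻¹' {k} =
      (fun ω => (({n : ℕ | p n ω}.encard : ℕ∞) : ℝ≥0∞)) ⁻¹' {(k : ℝ≥0∞)} := by
    ext ω
    simp
  rw [hk]
  exact h (measurableSet_singleton _)

lemma measurable_pointCount {Ω : Type*} [MeasurableSpace Ω] {X : ℕ → Ω → ℝ}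
    (hX : ∀ n, Measurable (X n)) {B : Set ℝ} (hB : MeasurableSet B) :
    Measurable (pointCount X B) :=
  measurable_encard_setOf fun n => hX n hB

lemma hasSum_poisson_pow (r : ℝ≥0) (s : ℝ) :
    HasSum (fun n : ℕ => (Real.exp (-r) * (r : ℝ) ^ n / (Nat.factorial n : ℝ)) • s ^ n)
      (Real.exp (-(r * (1 - s)))) := by
  have h := (NormedSpace.expSeries_div_hasSum_exp ((r : ℝ) * s)).mul_left (Real.exp (-r))
  rw [← Real.exp_eq_exp_ℝ, ← Real.exp_add] at h
  convert! h using 1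
  · ext n
    rw [smul_eq_mul, mul_pow]
    ring
  · congr 1
    ring

lemma integral_poisson_pow (r : ℝ≥0) (s : ℝ) :
    ∫ n : ℕ, s ^ n ∂poissonMeasure r = Real.exp (-(r * (1 - s))) := by
  rw [integral_poissonMeasure]
  exact (hasSum_poisson_pow r s).tsum_eq

/-- Size biasing: n rⁿ/n! = r · rⁿ⁻¹/(n - 1)!. The term n = 0 vanishes, so the truncated exponent
there does no harm. -/
lemma hasSum_poisson_mul_pow_pred (r : ℝ≥0) (s : ℝ) :
    HasSum (fun n : ℕ => (Real.exp (-r) * (r : ℝ) ^ n / (Nat.factorial n : ℝ)) •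
      ((n : ℝ) * s ^ (n - 1))) (r * Real.exp (-(r * (1 - s)))) := by
  rw [← hasSum_nat_add_iff' 1]
  simp only [Finset.sum_range_one, Nat.cast_zero, zero_mul, smul_zero, sub_zero]
  convert! (hasSum_poisson_pow r s).mul_left (r : ℝ) using 1
  ext n
  rw [Nat.factorial_succ, Nat.add_sub_cancel, smul_eq_mul, smul_eq_mul]
  push_cast
  field_simp
  ring

lemma integral_poisson_mul_pow_pred (r : ℝ≥0) (s : ℝ) :
    ∫ n : ℕ, (n : ℝ) * s ^ (n - 1) ∂poissonMeasure r = r * Real.exp (-(r * (1 - s))) := by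
  rw [integral_poissonMeasure]
  exact (hasSum_poisson_mul_pow_pred r s).tsum_eq

lemma integral_poisson_id (r : ℝ≥0) : ∫ n : ℕ, (n : ℝ) ∂poissonMeasure r = r := by
  simpa using integral_poisson_mul_pow_pred r 1

lemma integrable_poisson_id (r : ℝ≥0) :
    Integrable (fun n : ℕ => (n : ℝ)) (poissonMeasure r) := by
  rw [integrable_poissonMeasure_iff]
  simpa using (hasSum_poisson_mul_pow_pred r 1).summable

/-- The mean number of points of type `i`, each weighted by the probability of not surviving
independent trials carried by all the other points, for independent Poisson counts. -/
lemma lintegral_count_mul_one_sub_prod {Ω ι : Type*} [MeasurableSpace Ω] [Fintype ι]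
    [DecidableEq ι] {P : Measure Ω} [IsProbabilityMeasure P] {N : ι → Ω → ℕ} {r : ι → ℝ≥0}
    (hlaw : ∀ i, HasLaw (N i) (poissonMeasure (r i)) P) (hind : iIndepFun N P)
    {s : ι → ℝ} (hs0 : ∀ j, 0 ≤ s j) (hs1 : ∀ j, s j ≤ 1) (i : ι) :
    ∫⁻ ω, (N i ω : ℝ≥0∞) * ENNReal.ofReal (1 - ∏ j, s j ^ (N j ω - if j = i then 1 else 0)) ∂P =
      ENNReal.ofReal (r i * (1 - Real.exp (-∑ j, r j * (1 - s j)))) := by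
  set q : Ω → ℝ := fun ω => ∏ j, s j ^ (N j ω - if j = i then 1 else 0) with hq
  have hq0 : ∀ ω, 0 ≤ q ω := fun ω => Finset.prod_nonneg fun j _ => pow_nonneg (hs0 j) _
  have hq1 : ∀ ω, q ω ≤ 1 := fun ω =>
    Finset.prod_le_one (fun j _ => pow_nonneg (hs0 j) _) fun j _ => pow_le_one₀ (hs0 j) (hs1 j)
  have haem : ∀ j, AEMeasurable (N j) P := fun j => (hlaw j).aemeasurable
  have hNint : Integrable (fun ω => (N i ω : ℝ)) P := by
    have := integrable_poisson_id (r i)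
    rw [← (hlaw i).map_eq] at this
    exact this.comp_aemeasurable (haem i)
  have hqm : AEStronglyMeasurable q P := by
    refine AEMeasurable.aestronglyMeasurable ?_
    refine Finset.aemeasurable_fun_prod _ fun j _ => ?_
    exact (measurable_from_nat (f := fun n : ℕ => s j ^ (n - if j = i then 1 else 0))).comp_aemeasurable
      (haem j)
  have hNq : Integrable (fun ω => (N i ω : ℝ) * q ω) P := by
    refine hNint.mono (hNint.aestronglyMeasurable.mul hqm) (ae_of_all _ fun ω => ?_)
    rw [norm_mul, Real.norm_of_nonneg (hq0 ω)]
    exact mul_le_of_le_one_right (norm_nonneg _) (hq1 ω)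
  have hpt : ∀ ω, (N i ω : ℝ≥0∞) * ENNReal.ofReal (1 - q ω) =
      ENNReal.ofReal (N i ω - N i ω * q ω) := fun ω => by
    rw [← ENNReal.ofReal_natCast, ← ENNReal.ofReal_mul (Nat.cast_nonneg _), mul_sub, mul_one]
  have hlawint : ∀ j (f : ℕ → ℝ), ∫ ω, f (N j ω) ∂P = ∫ n, f n ∂poissonMeasure (r j) :=
    fun j f => by
      rw [← (hlaw j).map_eq, integral_map (haem j) (by fun_prop)]
  have hdiff : Integrable (fun ω => (N i ω : ℝ) - N i ω * q ω) P := hNint.sub hNq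
  rw [lintegral_congr hpt, ← ofReal_integral_eq_lintegral_ofReal hdiff
    (ae_of_all _ fun ω => sub_nonneg.2 (mul_le_of_le_one_right (Nat.cast_nonneg _) (hq1 ω))),
    integral_sub hNint hNq, hlawint i (fun n => (n : ℝ)), integral_poisson_id]
  congr 1
  -- The weight `N i` is absorbed into the factor of index `i`, so that the integrand is a product
  -- of functions of single counts and independence factorises its mean.
  let f : ι → ℕ → ℝ := fun j n => (if j = i then (n : ℝ) else 1) * s j ^ (n - if j = i then 1 else 0)
  have hprod : ∀ ω, (N i ω : ℝ) * q ω = ∏ j, f j (N j ω) := fun ω => by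
    simp only [f, Finset.prod_mul_distrib, hq]
    congr 1
    simp
  have hval : ∀ j, ∫ ω, f j (N j ω) ∂P =
      (if j = i then (r i : ℝ) else 1) * Real.exp (-(r j * (1 - s j))) := fun j => by
    rw [hlawint j (f j)]
    by_cases hj : j = i
    · subst hj
      simp only [f, if_true]
      exact integral_poisson_mul_pow_pred _ _
    · simp only [f, hj, if_false, one_mul, Nat.sub_zero]
      exact integral_poisson_pow _ _
  simp_rw [hprod]
  rw [hind.integral_fun_prod_comp haem (fun j => by fun_prop)]
  simp_rw [hval]
  rw [Finset.prod_mul_distrib, ← Real.exp_sum, Finset.sum_neg_distrib]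
  simp
  ring

/-! ### Step kernels: reduction to finitely many independent counts. -/

/-- The probability that the point `x n` has a neighbour `x z`, `z ≠ n`, when these neighbours are
chosen independently with probabilities `ψ (x n) (x z)`. -/
noncomputable def neighbourProb (ψ : ℝ → ℝ → ℝ) (x : ℕ → ℝ) (n : ℕ) : ℝ≥0∞ :=
  ⨆ K : ℕ, ENNReal.ofReal (1 - ∏ z ∈ (Finset.range K).erase n, (1 - ψ (x n) (x z)))

section StepKernel

variable {ι : Type*} [DecidableEq ι] {c : ℝ → ι} {S : Finset ι} {a : ι → ι → ℝ}

/-- Only the finitely many points of `A` contribute a factor different from 1, so the supremum over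
`K` is attained. Grouping the factors by cell gives powers of the cell counts; the point `n` is not
its own neighbour, hence the count of its own cell drops by one. -/
lemma neighbourProb_step {x : ℕ → ℝ} (ha0 : ∀ i j, 0 ≤ a i j) (ha1 : ∀ i j, a i j ≤ 1)
    (haS : ∀ i, ∀ j ∉ S, a i j = 0) {A : Finset ℕ} (hA : ∀ n, n ∈ A ↔ c (x n) ∈ S) (n : ℕ) :
    neighbourProb (fun y z => a (c y) (c z)) x n =
      ENNReal.ofReal (1 - ∏ j ∈ S, (1 - a (c (x n)) j) ^
        ((A.filter fun k => c (x k) = j).card - if j = c (x n) then 1 else 0)) := by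
  set b : ℕ → ℝ := fun z => 1 - a (c (x n)) (c (x z)) with hb
  have hb0 : ∀ z, 0 ≤ b z := fun z => sub_nonneg.2 (ha1 _ _)
  have hb1 : ∀ z, b z ≤ 1 := fun z => sub_le_self _ (ha0 _ _)
  have hbA : ∀ z ∉ A, b z = 1 := fun z hz => by
    simp only [hb, haS _ _ (fun h => hz ((hA z).2 h)), sub_zero]
  have hfiber : ∏ z ∈ A.erase n, b z = ∏ j ∈ S, (1 - a (c (x n)) j) ^
        ((A.filter fun k => c (x k) = j).card - if j = c (x n) then 1 else 0) := by
    rw [← Finset.prod_fiberwise_of_maps_to (s := A.erase n) (t := S) (g := fun k => c (x k))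
      fun k hk => (hA k).1 (Finset.mem_of_mem_erase hk)]
    refine Finset.prod_congr rfl fun j hj => ?_
    rw [Finset.prod_congr rfl (g := fun _ => 1 - a (c (x n)) j) fun z hz => by
      simp only [hb, (Finset.mem_filter.1 hz).2], Finset.prod_const, Finset.filter_erase]
    congr 1
    split_ifs with h
    · rw [Finset.card_erase_of_mem]
      exact Finset.mem_filter.2 ⟨(hA n).2 (h ▸ hj), h.symm⟩
    · rw [Finset.erase_eq_of_notMem, Nat.sub_zero]
      exact fun h' => h (Finset.mem_filter.1 h').2.symm
  rw [← hfiber]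
  refine le_antisymm (iSup_le fun K => ENNReal.ofReal_le_ofReal (sub_le_sub_left ?_ _)) ?_
  · calc ∏ z ∈ A.erase n, b z ≤ ∏ z ∈ (A.erase n).filter (· ∈ Finset.range K), b z :=
          Finset.prod_le_prod_of_subset_of_le_one (Finset.filter_subset _ _)
            (fun z _ => hb0 z) fun z _ _ => hb1 z
      _ = ∏ z ∈ (Finset.range K).erase n, b z := by
          refine Finset.prod_subset (fun z hz => ?_) fun z hz hz' => hbA z fun hzA => hz' ?_
          · simp only [Finset.mem_filter, Finset.mem_erase] at hz ⊢
            exact ⟨hz.1.1, hz.2⟩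
          · simp only [Finset.mem_filter, Finset.mem_erase] at hz ⊢
            exact ⟨⟨hz.1, hzA⟩, hz.2⟩
  · obtain ⟨K, hK⟩ := A.exists_nat_subset_range
    refine le_iSup_of_le K (ENNReal.ofReal_le_ofReal (sub_le_sub_left (le_of_eq ?_) _))
    refine (Finset.prod_subset (Finset.erase_subset_erase _ hK) fun z hz hz' =>
      hbA z fun hzA => hz' ?_).symm
    exact Finset.mem_erase.2 ⟨(Finset.mem_erase.1 hz).1, hzA⟩

lemma tsum_neighbourProb_step {x : ℕ → ℝ} (ha0 : ∀ i j, 0 ≤ a i j) (ha1 : ∀ i j, a i j ≤ 1)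
    (haS : ∀ i, ∀ j ∉ S, a i j = 0) (haS' : ∀ i ∉ S, ∀ j, a i j = 0)
    {A : Finset ℕ} (hA : ∀ n, n ∈ A ↔ c (x n) ∈ S) :
    ∑' n, neighbourProb (fun y z => a (c y) (c z)) x n =
      ∑ i ∈ S, ((A.filter fun k => c (x k) = i).card : ℝ≥0∞) *
        ENNReal.ofReal (1 - ∏ j ∈ S, (1 - a i j) ^
          ((A.filter fun k => c (x k) = j).card - if j = i then 1 else 0)) := by
  rw [tsum_eq_sum (s := A), ← Finset.sum_fiberwise_of_maps_to (s := A) (t := S)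
    (g := fun k => c (x k)) fun k hk => (hA k).1 hk]
  · refine Finset.sum_congr rfl fun i _ => ?_
    rw [← nsmul_eq_mul, ← Finset.sum_const]
    refine Finset.sum_congr rfl fun n hn => ?_
    rw [neighbourProb_step ha0 ha1 haS hA, (Finset.mem_filter.1 hn).2]
  · intro n hn
    rw [neighbourProb_step ha0 ha1 haS hA, Finset.prod_eq_one, sub_self, ENNReal.ofReal_zero]
    intro j _
    rw [haS' _ (fun h => hn ((hA n).2 h)), sub_zero, one_pow]

/-- The mean number of points of a Poisson process with a neighbour, for a kernel that is constant
on products of cells and vanishes outside of finitely many cells. -/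
lemma IsPoissonProcess.lintegral_tsum_neighbourProb_step {Ω : Type*} [MeasurableSpace Ω]
    {P : Measure Ω} [IsProbabilityMeasure P] {ρ : ℝ} {X : ℕ → Ω → ℝ}
    (hX : IsPoissonProcess P ρ X) (hρ : 0 ≤ ρ) (ha0 : ∀ i j, 0 ≤ a i j)
    (ha1 : ∀ i j, a i j ≤ 1) (haS : ∀ i, ∀ j ∉ S, a i j = 0) (haS' : ∀ i ∉ S, ∀ j, a i j = 0)
    (hc : ∀ i, MeasurableSet (c ⁻¹' {i})) (hvol : ∀ i ∈ S, volume (c ⁻¹' {i}) ≠ ∞) :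
    ∫⁻ ω, ∑' n, neighbourProb (fun y z => a (c y) (c z)) (fun n => X n ω) n ∂P =
      ∑ i ∈ S, ENNReal.ofReal (ρ * volume.real (c ⁻¹' {i}) *
        (1 - Real.exp (-∑ j ∈ S, ρ * volume.real (c ⁻¹' {j}) * a i j))) := by
  set N : S → Ω → ℕ := fun i ω => (pointCount X (c ⁻¹' {i.1}) ω).toNat with hN
  have hNmeas : ∀ i, Measurable (N i) := fun i =>
    (measurable_from_top (f := ENat.toNat)).comp (measurable_pointCount hX.measurable (hc i))
  have hlaw : ∀ i : S, HasLaw (N i)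
      (poissonMeasure (ρ * volume.real (c ⁻¹' {i.1})).toNNReal) P := fun i => by
    refine ⟨(hNmeas i).aemeasurable, ?_⟩
    have h := (hX.law _ (hc i) (hvol i i.2)).map_eq
    have h2 := congrArg (Measure.map ENat.toNat) h
    rw [Measure.map_map measurable_from_top (measurable_pointCount hX.measurable (hc i)),
      Measure.map_map measurable_from_top measurable_from_top] at h2
    rw [show N i = ENat.toNat ∘ pointCount X (c ⁻¹' {i.1}) from rfl, h2]
    convert! Measure.map_id
  -- The prescribed law lives on finite values, so counts are almost surely finite and `ENat.toNat`
  -- loses nothing.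
  have hfin : ∀ i ∈ S, ∀ᵐ ω ∂P, {n | X n ω ∈ c ⁻¹' {i}}.Finite := fun i hi => by
    have h := hX.law _ (hc i) (hvol i hi)
    have h2 : ∀ᵐ k ∂((poissonMeasure (ρ * volume.real (c ⁻¹' {i})).toNNReal).map
        (Nat.cast : ℕ → ℕ∞)), k ≠ ⊤ := by
      rw [ae_map_iff measurable_from_top.aemeasurable (MeasurableSet.of_discrete)]
      exact ae_of_all _ fun k => ENat.natCast_ne_top k
    rw [← h.map_eq] at h2
    filter_upwards [ae_of_ae_map h.aemeasurable h2] with ω hω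
    exact Set.encard_ne_top_iff.1 hω
  have hind : iIndepFun N P := by
    have h := hX.indep S.card (fun k => c ⁻¹' {(S.equivFin.symm k).1}) (fun k => hc _)
      fun k l hkl => by
        refine Disjoint.preimage _ (Set.disjoint_singleton.2 fun h => hkl ?_)
        exact S.equivFin.symm.injective (Subtype.ext h)
    have h2 := h.precomp S.equivFin.injective
    have h3 := h2.comp (fun _ => ENat.toNat) fun _ => measurable_from_top
    convert! h3 using 2 with i
    ext ω
    simp [hN]
  have hpt : ∀ᵐ ω ∂P, ∑' n, neighbourProb (fun y z => a (c y) (c z)) (fun n => X n ω) n =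
      ∑ i : S, (N i ω : ℝ≥0∞) * ENNReal.ofReal (1 - ∏ j : S, (1 - a i j) ^
          (N j ω - if j = i then 1 else 0)) := by
    filter_upwards [(Finset.eventually_all S).2 hfin] with ω hω
    have hfinA : {n | c (X n ω) ∈ S}.Finite := by
      refine (S.finite_toSet.biUnion hω).subset fun n hn => ?_
      exact Set.mem_biUnion (x := c (X n ω)) hn rfl
    have hA : ∀ n, n ∈ hfinA.toFinset ↔ c (X n ω) ∈ S := fun n => by simp
    have hcard : ∀ i : S, (hfinA.toFinset.filter fun k => c (X k ω) = i).card = N i ω :=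
      fun i => by
      have : pointCount X (c ⁻¹' {i.1}) ω =
          ((hfinA.toFinset.filter fun k => c (X k ω) = i : Finset ℕ) : Set ℕ).encard := by
        rw [pointCount]
        congr 1
        ext n
        have := i.2
        simp only [Set.mem_ofPred_eq, Set.mem_preimage, Set.mem_singleton_iff, Finset.coe_filter,
          hA]
        exact ⟨fun h => ⟨h ▸ this, h⟩, fun h => h.2⟩
      rw [hN]
      simp only [this, Set.encard_coe_eq_coe_finsetCard, ENat.toNat_natCast]
    rw [tsum_neighbourProb_step ha0 ha1 haS haS' hA, ← Finset.sum_coe_sort S]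
    refine Finset.sum_congr rfl fun i _ => ?_
    rw [hcard, ← Finset.prod_coe_sort S]
    simp_rw [hcard, Subtype.ext_iff]
  rw [lintegral_congr_ae hpt, lintegral_finsetSum' _ fun i _ => ?_, ← Finset.sum_coe_sort S]
  · refine Finset.sum_congr rfl fun i _ => ?_
    rw [lintegral_count_mul_one_sub_prod hlaw hind (s := fun j => 1 - a i j)
      (fun j => sub_nonneg.2 (ha1 _ _)) (fun j => sub_le_self _ (ha0 _ _)) i,
      ← Finset.sum_coe_sort S]
    have hnn : ∀ i : ι, 0 ≤ ρ * volume.real (c ⁻¹' {i}) := fun i => by positivity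
    simp_rw [Real.coe_toNNReal _ (hnn _), sub_sub_cancel]
  · refine Measurable.aemeasurable ?_
    refine Measurable.mul ?_ (ENNReal.measurable_ofReal.comp (Measurable.const_sub ?_ _))
    · exact (measurable_from_nat (f := fun n : ℕ => (n : ℝ≥0∞))).comp (hNmeas i)
    · refine Finset.measurable_fun_prod _ fun j _ => ?_
      exact (measurable_from_nat
        (f := fun n : ℕ => (1 - a i j) ^ (n - if j = i then 1 else 0))).comp (hNmeas j)

end StepKernel

section StepKernel

variable {ι : Type*} [DecidableEq ι] {c : ℝ → ι} {S : Finset ι} {a : ι → ι → ℝ}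

/-- A function of the cell alone that vanishes off `S` is a finite combination of indicators of
cells. -/
lemma lintegral_comp_cell (hc : ∀ i, MeasurableSet (c ⁻¹' {i})) {F : ι → ℝ≥0∞}
    (hF : ∀ i ∉ S, F i = 0) :
    ∫⁻ x, F (c x) = ∑ i ∈ S, F i * volume (c ⁻¹' {i}) := by
  have h : ∀ x, F (c x) = ∑ i ∈ S, (c ⁻¹' {i}).indicator (fun _ => F i) x := fun x => by
    by_cases hx : c x ∈ S
    · rw [Finset.sum_eq_single_of_mem (c x) hx, Set.indicator_of_mem (show x ∈ c ⁻¹' {c x} from rfl)]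
      exact fun j _ hj => Set.indicator_of_notMem (fun h => hj h.symm) _
    · rw [hF _ hx, Finset.sum_eq_zero]
      exact fun j hj => Set.indicator_of_notMem (fun h => hx ((h : c x = j) ▸ hj)) _
  rw [lintegral_congr h, lintegral_finsetSum _ fun i _ => measurable_const.indicator (hc i)]
  exact Finset.sum_congr rfl fun i _ => lintegral_indicator_const (hc i) _

/-- The mean number of points with a neighbour, for a Poisson process on the line of intensity `ρ`
whose points are joined according to the kernel `ψ`. -/
noncomputable def meanNeighbourIntegral (ρ : ℝ) (ψ : ℝ → ℝ → ℝ) : ℝ≥0∞ :=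
  ∫⁻ x, ENNReal.ofReal (ρ * (1 - Real.exp (-(ρ * (∫⁻ y, ENNReal.ofReal (ψ x y)).toReal))))

lemma meanNeighbourIntegral_step {ρ : ℝ} (ha0 : ∀ i j, 0 ≤ a i j)
    (haS : ∀ i, ∀ j ∉ S, a i j = 0) (haS' : ∀ i ∉ S, ∀ j, a i j = 0)
    (hc : ∀ i, MeasurableSet (c ⁻¹' {i})) (hvol : ∀ i ∈ S, volume (c ⁻¹' {i}) ≠ ∞) :
    meanNeighbourIntegral ρ (fun x y => a (c x) (c y)) =
      ∑ i ∈ S, ENNReal.ofReal (ρ * volume.real (c ⁻¹' {i}) *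
        (1 - Real.exp (-∑ j ∈ S, ρ * volume.real (c ⁻¹' {j}) * a i j))) := by
  have hinner : ∀ i, ∫⁻ y, ENNReal.ofReal (a i (c y)) =
      ∑ j ∈ S, ENNReal.ofReal (a i j) * volume (c ⁻¹' {j}) := fun i =>
    lintegral_comp_cell (F := fun j => ENNReal.ofReal (a i j)) hc
      fun j hj => by rw [haS i j hj, ENNReal.ofReal_zero]
  unfold meanNeighbourIntegral
  rw [lintegral_comp_cell (S := S) (F := fun i => ENNReal.ofReal (ρ * (1 - Real.exp
    (-(ρ * (∫⁻ y, ENNReal.ofReal (a i (c y))).toReal))))) hc]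
  · refine Finset.sum_congr rfl fun i hi => ?_
    rw [hinner, ENNReal.toReal_sum fun j hj => ENNReal.mul_ne_top ENNReal.ofReal_ne_top (hvol j hj),
      ← ENNReal.ofReal_toReal (hvol i hi), ← ENNReal.ofReal_mul' ENNReal.toReal_nonneg,
      Finset.mul_sum]
    have hsum : ∑ j ∈ S, ρ * (ENNReal.ofReal (a i j) * volume (c ⁻¹' {j})).toReal =
        ∑ j ∈ S, ρ * volume.real (c ⁻¹' {j}) * a i j := Finset.sum_congr rfl fun j _ => by
      rw [ENNReal.toReal_mul, ENNReal.toReal_ofReal (ha0 _ _), measureReal_def]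
      ring
    rw [hsum, mul_right_comm, measureReal_def]
  · intro i hi
    simp [haS' i hi]

end StepKernel

/-! ### Dyadic approximation of a continuous kernel from below. -/

/-- The index of the dyadic interval of length `2⁻ᵐ` that contains `x`. -/
noncomputable def dyadicCell (m : ℕ) (x : ℝ) : ℤ := ⌊(2 : ℝ) ^ m * x⌋

/-- The indices of the dyadic intervals of length `2⁻ᵐ` contained in `[-2ᵐ, 2ᵐ)`. -/
noncomputable def dyadicWindow (m : ℕ) : Finset ℤ := Finset.Ico (-4 ^ m) (4 ^ m)

open Classical in
/-- The infimum of `φ` on a product of dyadic intervals, set to `0` outside of a bounded window. -/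
noncomputable def dyadicInf (φ : ℝ → ℝ → ℝ) (m : ℕ) (i j : ℤ) : ℝ :=
  if i ∈ dyadicWindow m ∧ j ∈ dyadicWindow m then
    ⨅ p : {p : ℝ × ℝ // dyadicCell m p.1 = i ∧ dyadicCell m p.2 = j}, φ p.1.1 p.1.2
  else 0

lemma measurable_dyadicCell (m : ℕ) : Measurable (dyadicCell m) :=
  Int.measurable_floor.comp (measurable_id.const_mul _)

lemma volume_dyadicCell_ne_top (m : ℕ) (i : ℤ) : volume (dyadicCell m ⁻¹' {i}) ≠ ∞ := by
  have h : dyadicCell m ⁻¹' {i} ⊆ Set.Icc (i / 2 ^ m : ℝ) ((i + 1) / 2 ^ m) := fun x hx => by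
    have h := Int.floor_eq_iff.1 (hx : ⌊(2 : ℝ) ^ m * x⌋ = i)
    rw [Set.mem_Icc, div_le_iff₀ (by positivity), le_div_iff₀ (by positivity), mul_comm x]
    exact ⟨h.1, h.2.le⟩
  exact ((measure_mono h).trans_lt measure_Icc_lt_top).ne

/-- Dyadic intervals are nested; the division is integer floor division, so this holds for negative
indices too. The monotonicity in `m` of `dyadicInf` depends on it. -/
lemma dyadicCell_eq_succ_div_two (m : ℕ) (x : ℝ) : dyadicCell m x = dyadicCell (m + 1) x / 2 := by
  have h := Int.floor_div_natCast ((2 : ℝ) ^ (m + 1) * x) 2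
  rw [Nat.cast_ofNat, pow_succ, mul_right_comm, Nat.cast_ofNat,
    mul_div_cancel_right₀ _ two_ne_zero] at h
  rw [dyadicCell, dyadicCell, pow_succ, mul_right_comm, h]

lemma dyadicCell_succ_mem_window {m : ℕ} {x : ℝ} (h : dyadicCell m x ∈ dyadicWindow m) :
    dyadicCell (m + 1) x ∈ dyadicWindow (m + 1) := by
  rw [dyadicCell_eq_succ_div_two, dyadicWindow, Finset.mem_Ico] at h
  rw [dyadicWindow, Finset.mem_Ico, pow_succ]
  have : (0 : ℤ) < 4 ^ m := by positivity
  omega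

lemma eventually_dyadicCell_mem_window (x : ℝ) :
    ∀ᶠ m in atTop, dyadicCell m x ∈ dyadicWindow m := by
  have h : Tendsto (fun m : ℕ => (2 : ℝ) ^ m) atTop atTop :=
    tendsto_pow_atTop_atTop_of_one_lt one_lt_two
  filter_upwards [h.eventually_gt_atTop |x|] with m hm
  have hpos : (0 : ℝ) < 2 ^ m := by positivity
  have h4 : (4 : ℝ) ^ m = 2 ^ m * 2 ^ m := by rw [← mul_pow]; norm_num
  have hx := abs_lt.1 hm
  rw [dyadicWindow, Finset.mem_Ico, dyadicCell, Int.le_floor, Int.floor_lt]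
  push_cast
  rw [h4]
  constructor <;> nlinarith

section DyadicInf

variable {φ : ℝ → ℝ → ℝ}

lemma dyadicInf_nonneg (h0 : ∀ x y, 0 ≤ φ x y) (m : ℕ) (i j : ℤ) : 0 ≤ dyadicInf φ m i j := by
  unfold dyadicInf
  split_ifs
  · exact Real.iInf_nonneg fun p => h0 _ _
  · exact le_rfl

lemma dyadicInf_of_notMem_left {m : ℕ} {i : ℤ} (hi : i ∉ dyadicWindow m) (j : ℤ) :
    dyadicInf φ m i j = 0 :=
  if_neg fun h => hi h.1

lemma dyadicInf_of_notMem_right {m : ℕ} (i : ℤ) {j : ℤ} (hj : j ∉ dyadicWindow m) :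
    dyadicInf φ m i j = 0 :=
  if_neg fun h => hj h.2

lemma bddBelow_range_kernel (h0 : ∀ x y, 0 ≤ φ x y) {p : ℝ × ℝ → Prop} :
    BddBelow (Set.range fun q : {q // p q} => φ q.1.1 q.1.2) :=
  ⟨0, by rintro _ ⟨q, rfl⟩; exact h0 _ _⟩

lemma dyadicInf_le (h0 : ∀ x y, 0 ≤ φ x y) (m : ℕ) (x y : ℝ) :
    dyadicInf φ m (dyadicCell m x) (dyadicCell m y) ≤ φ x y := by
  unfold dyadicInf
  split_ifs
  · exact ciInf_le (bddBelow_range_kernel h0) ⟨(x, y), rfl, rfl⟩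
  · exact h0 _ _

lemma dyadicInf_le_one (h0 : ∀ x y, 0 ≤ φ x y) (h1 : ∀ x y, φ x y ≤ 1) (m : ℕ) (i j : ℤ) :
    dyadicInf φ m i j ≤ 1 := by
  have hsurj : ∀ i : ℤ, ∃ x, dyadicCell m x = i := fun i =>
    ⟨i / 2 ^ m, by rw [dyadicCell, mul_div_cancel₀ _ (by positivity), Int.floor_intCast]⟩
  obtain ⟨x, rfl⟩ := hsurj i
  obtain ⟨y, rfl⟩ := hsurj j
  exact (dyadicInf_le h0 m x y).trans (h1 x y)

/-- Refining the cells takes the infimum over a smaller set, and a cell inside the window stays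
inside; outside the window the value is 0, which nonnegativity makes minimal. -/
lemma monotone_dyadicInf (h0 : ∀ x y, 0 ≤ φ x y) (x y : ℝ) :
    Monotone fun m => dyadicInf φ m (dyadicCell m x) (dyadicCell m y) := by
  refine monotone_nat_of_le_succ fun m => ?_
  by_cases h : dyadicCell m x ∈ dyadicWindow m ∧ dyadicCell m y ∈ dyadicWindow m
  · have h' := And.intro (dyadicCell_succ_mem_window h.1) (dyadicCell_succ_mem_window h.2)
    rw [dyadicInf, if_pos h, dyadicInf, if_pos h']
    have : Nonempty {p : ℝ × ℝ // dyadicCell (m + 1) p.1 = dyadicCell (m + 1) x ∧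
        dyadicCell (m + 1) p.2 = dyadicCell (m + 1) y} := ⟨⟨(x, y), rfl, rfl⟩⟩
    refine le_ciInf fun p => ciInf_le (bddBelow_range_kernel h0) ⟨p.1, ?_, ?_⟩
    · rw [dyadicCell_eq_succ_div_two, p.2.1, ← dyadicCell_eq_succ_div_two]
    · rw [dyadicCell_eq_succ_div_two, p.2.2, ← dyadicCell_eq_succ_div_two]
  · rw [dyadicInf, if_neg h]
    exact dyadicInf_nonneg h0 _ _ _

lemma dist_lt_of_dyadicCell_eq {m : ℕ} {x y : ℝ} (h : dyadicCell m x = dyadicCell m y) :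
    dist x y < (1 / 2) ^ m := by
  have h := Int.abs_sub_lt_one_of_floor_eq_floor h
  rw [← mul_sub, abs_mul, abs_of_pos (by positivity)] at h
  rwa [Real.dist_eq, one_div, inv_pow, ← one_div, lt_div_iff₀' (by positivity)]

/-- The point (x, y) eventually enters the window, and its cell shrinks to it, so continuity at that
point brings the infimum within ε/2 of the value. -/
lemma tendsto_dyadicInf (h0 : ∀ x y, 0 ≤ φ x y) (hφ : Continuous fun p : ℝ × ℝ => φ p.1 p.2)
    (x y : ℝ) :
    Tendsto (fun m => dyadicInf φ m (dyadicCell m x) (dyadicCell m y)) atTop (𝓝 (φ x y)) := by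
  rw [Metric.tendsto_nhds]
  intro ε hε
  obtain ⟨δ, hδ, hcont⟩ := Metric.continuous_iff.1 hφ (x, y) (ε / 2) (by positivity)
  have hpow : Tendsto (fun m : ℕ => (1 / 2 : ℝ) ^ m) atTop (𝓝 0) :=
    tendsto_pow_atTop_nhds_zero_of_lt_one (by norm_num) (by norm_num)
  filter_upwards [hpow.eventually_lt_const hδ, eventually_dyadicCell_mem_window x,
    eventually_dyadicCell_mem_window y] with m hm hx hy
  have hle := dyadicInf_le h0 m x y
  have hge : φ x y - ε / 2 ≤ dyadicInf φ m (dyadicCell m x) (dyadicCell m y) := by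
    rw [dyadicInf, if_pos ⟨hx, hy⟩]
    have : Nonempty {p : ℝ × ℝ // dyadicCell m p.1 = dyadicCell m x ∧
        dyadicCell m p.2 = dyadicCell m y} := ⟨⟨(x, y), rfl, rfl⟩⟩
    refine le_ciInf fun p => ?_
    have h := hcont p.1 (max_lt ((dist_lt_of_dyadicCell_eq p.2.1).trans hm)
      ((dist_lt_of_dyadicCell_eq p.2.2).trans hm))
    rw [Real.dist_eq, abs_lt] at h
    linarith [h.1]
  rw [Real.dist_eq, abs_lt]
  constructor <;> linarith

end DyadicInf

/-! ### Monotone passage from step kernels to continuous kernels. -/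

section MonotoneLimit

variable {ψ : ℕ → ℝ → ℝ → ℝ} {φ : ℝ → ℝ → ℝ}

lemma monotone_neighbourProb (hmono : ∀ x y, Monotone fun m => ψ m x y)
    (h1 : ∀ m x y, ψ m x y ≤ 1) (x : ℕ → ℝ) (n : ℕ) :
    Monotone fun m => neighbourProb (ψ m) x n := fun _ _ hkl =>
  iSup_mono fun _ => ENNReal.ofReal_le_ofReal (sub_le_sub_left (Finset.prod_le_prod
    (fun _ _ => sub_nonneg.2 (h1 _ _ _)) fun _ _ => sub_le_sub_left (hmono _ _ hkl) _) _)

/-- The suprema over `m` and `K` commute, and for fixed `K` only a finite product has to converge.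
-/
lemma iSup_neighbourProb (hmono : ∀ x y, Monotone fun m => ψ m x y) (h1 : ∀ m x y, ψ m x y ≤ 1)
    (hlim : ∀ x y, Tendsto (fun m => ψ m x y) atTop (𝓝 (φ x y))) (x : ℕ → ℝ) (n : ℕ) :
    ⨆ m, neighbourProb (ψ m) x n = neighbourProb φ x n := by
  unfold neighbourProb
  rw [iSup_comm]
  refine iSup_congr fun K => iSup_eq_of_tendsto (fun k l hkl => ?_) ?_
  · exact ENNReal.ofReal_le_ofReal (sub_le_sub_left (Finset.prod_le_prod
      (fun _ _ => sub_nonneg.2 (h1 _ _ _)) fun _ _ => sub_le_sub_left (hmono _ _ hkl) _) _)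
  · exact ENNReal.tendsto_ofReal ((tendsto_finsetProd _ fun z _ =>
      (hlim _ _).const_sub 1).const_sub 1)

lemma measurable_neighbourProb {Ω : Type*} [MeasurableSpace Ω] {X : ℕ → Ω → ℝ}
    (hX : ∀ n, Measurable (X n)) (hφ : Measurable fun p : ℝ × ℝ => φ p.1 p.2) (n : ℕ) :
    Measurable fun ω => neighbourProb φ (fun k => X k ω) n := by
  refine Measurable.iSup fun K => ENNReal.measurable_ofReal.comp (Measurable.const_sub ?_ _)
  refine Finset.measurable_fun_prod _ fun z _ => Measurable.const_sub ?_ _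
  exact hφ.comp ((hX n).prodMk (hX z))

lemma tendsto_meanNeighbourIntegral {ρ : ℝ} (hρ : 0 ≤ ρ)
    (hmeas : ∀ m, Measurable fun p : ℝ × ℝ => ψ m p.1 p.2)
    (hmono : ∀ x y, Monotone fun m => ψ m x y)
    (hlim : ∀ x y, Tendsto (fun m => ψ m x y) atTop (𝓝 (φ x y)))
    (hfin : ∀ x, ∫⁻ y, ENNReal.ofReal (φ x y) ≠ ∞) :
    Tendsto (fun m => meanNeighbourIntegral ρ (ψ m)) atTop (𝓝 (meanNeighbourIntegral ρ φ)) := by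
  have hle : ∀ m x y, ψ m x y ≤ φ x y := fun m x y => (hmono x y).ge_of_tendsto (hlim x y) m
  have hinner : ∀ x, Tendsto (fun m => ∫⁻ y, ENNReal.ofReal (ψ m x y)) atTop
      (𝓝 (∫⁻ y, ENNReal.ofReal (φ x y))) := fun x =>
    lintegral_tendsto_of_tendsto_of_monotone
      (fun m => (ENNReal.measurable_ofReal.comp ((hmeas m).comp measurable_prodMk_left)).aemeasurable)
      (ae_of_all _ fun y k l hkl => ENNReal.ofReal_le_ofReal (hmono x y hkl))
      (ae_of_all _ fun y => ENNReal.tendsto_ofReal (hlim x y))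
  -- Finiteness is what makes `toReal` monotone and continuous at the inner integrals, as it sends ∞
  -- to 0.
  have hfin' : ∀ m x, ∫⁻ y, ENNReal.ofReal (ψ m x y) ≠ ∞ := fun m x =>
    ne_top_of_le_ne_top (hfin x) (lintegral_mono fun y => ENNReal.ofReal_le_ofReal (hle m x y))
  refine lintegral_tendsto_of_tendsto_of_monotone (fun m => ?_) (ae_of_all _ fun x k l hkl => ?_)
    (ae_of_all _ fun x => ?_)
  · have h : Measurable fun x => ∫⁻ y, ENNReal.ofReal (ψ m x y) :=
      (ENNReal.measurable_ofReal.comp (hmeas m)).lintegral_prod_right'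
    have h2 := h.ennreal_toReal
    fun_prop
  · have h : (∫⁻ y, ENNReal.ofReal (ψ k x y)).toReal ≤ (∫⁻ y, ENNReal.ofReal (ψ l x y)).toReal :=
      ENNReal.toReal_mono (hfin' l x)
        (lintegral_mono fun y => ENNReal.ofReal_le_ofReal (hmono x y hkl))
    dsimp only
    gcongr
  · have h := (ENNReal.tendsto_toReal (hfin x)).comp (hinner x)
    exact ENNReal.tendsto_ofReal ((((Real.continuous_exp.tendsto _).comp
      (h.const_mul ρ).neg).const_sub 1).const_mul ρ)

end MonotoneLimit

/-- The mean number of points of a Poisson process with a neighbour, for a continuous kernel. -/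
theorem IsPoissonProcess.lintegral_tsum_neighbourProb {Ω : Type*} [MeasurableSpace Ω]
    {P : Measure Ω} [IsProbabilityMeasure P] {ρ : ℝ} {X : ℕ → Ω → ℝ}
    (hX : IsPoissonProcess P ρ X) (hρ : 0 ≤ ρ) {φ : ℝ → ℝ → ℝ} (h0 : ∀ x y, 0 ≤ φ x y)
    (h1 : ∀ x y, φ x y ≤ 1) (hφ : Continuous fun p : ℝ × ℝ => φ p.1 p.2)
    (hfin : ∀ x, ∫⁻ y, ENNReal.ofReal (φ x y) ≠ ∞) :
    ∫⁻ ω, ∑' n, neighbourProb φ (fun k => X k ω) n ∂P = meanNeighbourIntegral ρ φ := by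
  classical
  set ψ : ℕ → ℝ → ℝ → ℝ := fun m x y => dyadicInf φ m (dyadicCell m x) (dyadicCell m y) with hψ
  have hmono : ∀ x y, Monotone fun m => ψ m x y := monotone_dyadicInf h0
  have hlim : ∀ x y, Tendsto (fun m => ψ m x y) atTop (𝓝 (φ x y)) := tendsto_dyadicInf h0 hφ
  have hψ1 : ∀ m x y, ψ m x y ≤ 1 := fun m x y => dyadicInf_le_one h0 h1 _ _ _
  have hmeas : ∀ m, Measurable fun p : ℝ × ℝ => ψ m p.1 p.2 := fun m =>
    (Measurable.of_discrete (f := fun q : ℤ × ℤ => dyadicInf φ m q.1 q.2)).comp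
      (((measurable_dyadicCell m).comp measurable_fst).prodMk
        ((measurable_dyadicCell m).comp measurable_snd))
  have hcell : ∀ m i, MeasurableSet (dyadicCell m ⁻¹' {i}) := fun m i =>
    measurable_dyadicCell m (measurableSet_singleton i)
  have hstep : ∀ m, ∫⁻ ω, ∑' n, neighbourProb (ψ m) (fun k => X k ω) n ∂P =
      meanNeighbourIntegral ρ (ψ m) := fun m => by
    rw [hψ, meanNeighbourIntegral_step (S := dyadicWindow m) (dyadicInf_nonneg h0 m)
      (fun i j hj => dyadicInf_of_notMem_right i hj) (fun i hi j => dyadicInf_of_notMem_left hi j)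
      (hcell m) (fun i _ => volume_dyadicCell_ne_top m i)]
    exact hX.lintegral_tsum_neighbourProb_step hρ (dyadicInf_nonneg h0 m)
      (dyadicInf_le_one h0 h1 m)
      (fun i j hj => dyadicInf_of_notMem_right i hj) (fun i hi j => dyadicInf_of_notMem_left hi j)
      (hcell m) (fun i _ => volume_dyadicCell_ne_top m i)
  have hmonoP := monotone_neighbourProb hmono hψ1
  have htends : Tendsto (fun m => ∫⁻ ω, ∑' n, neighbourProb (ψ m) (fun k => X k ω) n ∂P) atTop
      (𝓝 (∫⁻ ω, ∑' n, neighbourProb φ (fun k => X k ω) n ∂P)) := by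
    refine lintegral_tendsto_of_tendsto_of_monotone (fun m => ?_)
      (ae_of_all _ fun ω k l hkl => ?_) (ae_of_all _ fun ω => ?_)
    · exact (Measurable.tsum fun n =>
        measurable_neighbourProb hX.measurable (hmeas m) n).aemeasurable
    · exact ENNReal.tsum_le_tsum fun n => hmonoP _ n hkl
    -- The sum over points is read as an integral against counting measure, so that monotone
    -- convergence applies to it as well.
    · simp_rw [← lintegral_count]
      refine lintegral_tendsto_of_tendsto_of_monotone
        (fun m => measurable_from_top.aemeasurable)
        (ae_of_all _ fun n => hmonoP _ n) (ae_of_all _ fun n => ?_)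
      rw [← iSup_neighbourProb hmono hψ1 hlim]
      exact tendsto_atTop_iSup (hmonoP _ n)
  exact tendsto_nhds_unique htends
    ((tendsto_meanNeighbourIntegral hρ hmeas hmono hlim hfin).congr fun m => (hstep m).symm)

/-! ### Two-hop paths in the random connection model. -/

/-- Inclusion-exclusion: expanding ∏ (1 - f) leaves only the mixed moments over subsets, on which
the two families agree. -/
lemma integral_prod_one_sub_congr {Ω ι : Type*} [MeasurableSpace Ω] {P : Measure Ω}
    {R : Finset ι} {f g : ι → Ω → ℝ} (hf : ∀ T ⊆ R, Integrable (fun ω => ∏ z ∈ T, f z ω) P)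
    (hg : ∀ T ⊆ R, Integrable (fun ω => ∏ z ∈ T, g z ω) P)
    (hfg : ∀ T ⊆ R, ∫ ω, ∏ z ∈ T, f z ω ∂P = ∫ ω, ∏ z ∈ T, g z ω ∂P) :
    ∫ ω, ∏ z ∈ R, (1 - f z ω) ∂P = ∫ ω, ∏ z ∈ R, (1 - g z ω) ∂P := by
  classical
  have key : ∀ h : ι → Ω → ℝ, (∀ T ⊆ R, Integrable (fun ω => ∏ z ∈ T, h z ω) P) →
      ∫ ω, ∏ z ∈ R, (1 - h z ω) ∂P =
        ∑ T ∈ R.powerset, (-1) ^ T.card * ∫ ω, ∏ z ∈ T, h z ω ∂P := fun h hh => by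
    simp_rw [sub_eq_add_neg, Finset.prod_one_add, Finset.prod_neg]
    rw [integral_finsetSum _ fun T hT => (hh T (Finset.mem_powerset.1 hT)).const_mul _]
    exact Finset.sum_congr rfl fun T _ => integral_const_mul _ _
  rw [key f hf, key g hg]
  exact Finset.sum_congr rfl fun T hT => by rw [hfg T (Finset.mem_powerset.1 hT)]

/-- The probability that both links of the path `x ↔ y ↔ u` are present. -/
noncomputable def hopKernel (u x y : ℝ) : ℝ :=
  connectionFunction |x - y| * connectionFunction |y - u|

lemma connectionFunction_pos (r : ℝ) : 0 < connectionFunction r := Real.exp_pos _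

lemma connectionFunction_le_one (r : ℝ) : connectionFunction r ≤ 1 :=
  Real.exp_le_one_iff.2 (neg_nonpos.2 (sq_nonneg r))

lemma hopKernel_nonneg (u x y : ℝ) : 0 ≤ hopKernel u x y :=
  mul_nonneg (connectionFunction_pos _).le (connectionFunction_pos _).le

lemma hopKernel_le_one (u x y : ℝ) : hopKernel u x y ≤ 1 :=
  mul_le_one₀ (connectionFunction_le_one _) (connectionFunction_pos _).le
    (connectionFunction_le_one _)

lemma continuous_hopKernel (u : ℝ) : Continuous fun p : ℝ × ℝ => hopKernel u p.1 p.2 := by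
  unfold hopKernel connectionFunction
  fun_prop

/-- Completing the square about the midpoint: (x - y)² + (y - u)² = (x - u)²/2 + 2(y - (x + u)/2)².
-/
lemma hopKernel_eq (u x y : ℝ) :
    hopKernel u x y = Real.exp (-(x - u) ^ 2 / 2) * Real.exp (-2 * (y - (x + u) / 2) ^ 2) := by
  rw [hopKernel, connectionFunction, connectionFunction, ← Real.exp_add, ← Real.exp_add, sq_abs,
    sq_abs]
  congr 1
  ring

lemma integrable_hopKernel (u x : ℝ) : Integrable fun y => hopKernel u x y := by
  simp_rw [hopKernel_eq]
  exact ((integrable_exp_neg_mul_sq (b := 2) two_pos).comp_sub_right _).const_mul _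

lemma integral_hopKernel (u x : ℝ) :
    ∫ y, hopKernel u x y = √(Real.pi / 2) * Real.exp (-(x - u) ^ 2 / 2) := by
  simp_rw [hopKernel_eq]
  rw [integral_const_mul,
    integral_sub_right_eq_self (fun y : ℝ => Real.exp (-2 * y ^ 2)) ((x + u) / 2),
    integral_gaussian, mul_comm]

lemma lintegral_hopKernel (u x : ℝ) :
    ∫⁻ y, ENNReal.ofReal (hopKernel u x y) =
      ENNReal.ofReal (√(Real.pi / 2) * Real.exp (-(x - u) ^ 2 / 2)) := by
  rw [← integral_hopKernel, ofReal_integral_eq_lintegral_ofReal (integrable_hopKernel u x)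
    (ae_of_all _ (hopKernel_nonneg u x))]

lemma meanNeighbourIntegral_hopKernel {ρ : ℝ} (hρ : 0 ≤ ρ) (u : ℝ) :
    meanNeighbourIntegral ρ (hopKernel u) =
      ENNReal.ofReal (ρ * gaussianCoverage (ρ * √(Real.pi / 2))) := by
  have hc : 0 ≤ ρ * √(Real.pi / 2) := by positivity
  rw [← integral_sub_eq_gaussianCoverage _ u, ← integral_const_mul,
    ofReal_integral_eq_lintegral_ofReal
      (((integrable_gaussianCoverage hc).comp_sub_right u).const_mul ρ)
      (ae_of_all _ fun x => mul_nonneg hρ (one_sub_exp_neg_nonneg (by positivity)))]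
  refine lintegral_congr fun x => ?_
  rw [lintegral_hopKernel, ENNReal.toReal_ofReal (by positivity), mul_assoc]

/-- The links of the two-hop paths from the point `n` to the roadside unit through points of `T`. -/
def pathLinks (n : ℕ) (T : Finset ℕ) : Finset (Sym2 (Option ℕ)) :=
  T.image (fun z => s(some n, some z)) ∪ T.image fun z => s(some z, none)

/-- Distinct relays use distinct links, and a link between two points is never a link to the
roadside unit, so nothing is lost in the union of images. -/
lemma prod_pathLinks (u : ℝ) (n : ℕ) (T : Finset ℕ) (x : ℕ → ℝ) :
    ∏ e ∈ pathLinks n T, linkProbability u x e = ∏ z ∈ T, hopKernel u (x n) (x z) := by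
  rw [pathLinks, Finset.prod_union, Finset.prod_image, Finset.prod_image,
    ← Finset.prod_mul_distrib]
  · rfl
  · intro y _ z _ hyz
    simpa using hyz
  · intro y _ z _ hyz
    simp only [Sym2.eq_iff, Option.some.injEq] at hyz
    omega
  · rw [Finset.disjoint_left]
    intro e he he'
    obtain ⟨y, _, rfl⟩ := Finset.mem_image.1 he
    obtain ⟨z, _, hz⟩ := Finset.mem_image.1 he'
    simp at hz

/-- The event that there is a path from the point `n` to the roadside unit through the point `z`. -/
def pathEvent {Ω : Type*} (G : Ω → SimpleGraph (Option ℕ)) (n z : ℕ) : Set Ω :=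
  {ω | (G ω).Adj (some n) (some z) ∧ (G ω).Adj (some z) none}

/-- The roadside unit cannot be the relay, since that would require a loop at `none`. -/
lemma exists_path_iff {H : SimpleGraph (Option ℕ)} {n : ℕ} :
    (∃ z : Option ℕ, H.Adj (some n) z ∧ H.Adj z none) ↔
      ∃ z : ℕ, H.Adj (some n) (some z) ∧ H.Adj (some z) none := by
  constructor
  · rintro ⟨_ | z, h1, h2⟩
    · exact (H.irrefl h2).elim
    · exact ⟨z, h1, h2⟩
  · exact fun ⟨z, hz⟩ => ⟨some z, hz⟩

lemma setOf_exists_path {Ω : Type*} (G : Ω → SimpleGraph (Option ℕ)) (n : ℕ) :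
    {ω | ∃ z : Option ℕ, (G ω).Adj (some n) z ∧ (G ω).Adj z none} =
      ⋃ K : ℕ, ⋃ z ∈ (Finset.range K).erase n, pathEvent G n z := by
  ext ω
  simp only [Set.mem_ofPred_eq, exists_path_iff, Set.mem_iUnion, Finset.mem_erase,
    Finset.mem_range, pathEvent, exists_prop]
  constructor
  · rintro ⟨z, hz⟩
    exact ⟨z + 1, z, ⟨fun hzn => (G ω).irrefl (hzn ▸ hz.1), z.lt_succ_self⟩, hz⟩
  · rintro ⟨_, z, _, hz⟩
    exact ⟨z, hz⟩

section Links

variable {Ω : Type*} [MeasurableSpace Ω] {P : Measure Ω} {ρ u : ℝ}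
  {X : ℕ → Ω → ℝ} {G : Ω → SimpleGraph (Option ℕ)}

lemma IsRandomConnectionModel.measurableSet_pathEvent (h : IsRandomConnectionModel P ρ u X G)
    (n z : ℕ) : MeasurableSet (pathEvent G n z) :=
  (h.measurable_link _ _).inter (h.measurable_link _ _)

lemma IsRandomConnectionModel.measurable_hopKernel (h : IsRandomConnectionModel P ρ u X G)
    (n z : ℕ) : Measurable fun ω => hopKernel u (X n ω) (X z ω) := by
  have hn := h.poisson.measurable n
  have hz := h.poisson.measurable z
  unfold hopKernel connectionFunction
  fun_prop

lemma IsRandomConnectionModel.measurableSet_exists_path (h : IsRandomConnectionModel P ρ u X G)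
    (n : ℕ) :
    MeasurableSet {ω | ∃ z : Option ℕ, (G ω).Adj (some n) z ∧ (G ω).Adj z none} := by
  rw [setOf_exists_path]
  exact MeasurableSet.iUnion fun K =>
    Finset.measurableSet_biUnion _ fun z _ => h.measurableSet_pathEvent n z

lemma IsRandomConnectionModel.measurable_twoHopCount (h : IsRandomConnectionModel P ρ u X G) :
    Measurable (twoHopCount G) :=
  measurable_encard_setOf h.measurableSet_exists_path

variable [IsProbabilityMeasure P]

/-- Integrating the conditional probability given the positions removes the conditioning; only these
averaged identities are needed afterwards. -/
lemma IsRandomConnectionModel.measureReal_links (h : IsRandomConnectionModel P ρ u X G)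
    (E : Finset (Sym2 (Option ℕ))) (hE : ∀ e ∈ E, ¬ e.IsDiag) :
    P.real {ω | ∀ e ∈ E, e ∈ (G ω).edgeSet} =
      ∫ ω, ∏ e ∈ E, linkProbability u (fun n => X n ω) e ∂P := by
  have hm : MeasurableSpace.comap (fun ω n => X n ω) (inferInstance : MeasurableSpace (ℕ → ℝ)) ≤
      ‹MeasurableSpace Ω› :=
    (measurable_pi_lambda _ h.poisson.measurable).comap_le
  have hmeas : MeasurableSet {ω | ∀ e ∈ E, e ∈ (G ω).edgeSet} := by
    have : {ω | ∀ e ∈ E, e ∈ (G ω).edgeSet} = ⋂ e ∈ E, {ω | e ∈ (G ω).edgeSet} := by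
      ext ω
      simp
    rw [this]
    refine E.measurableSet_biInter fun e _ => ?_
    induction e with
    | h a b => exact h.measurable_link a b
  rw [← integral_congr_ae (h.links E hE), integral_condExp hm, integral_indicator hmeas]
  simp [measureReal_def]

lemma IsRandomConnectionModel.measureReal_paths (h : IsRandomConnectionModel P ρ u X G)
    {n : ℕ} {T : Finset ℕ} (hT : n ∉ T) :
    P.real {ω | ∀ z ∈ T, (G ω).Adj (some n) (some z) ∧ (G ω).Adj (some z) none} =
      ∫ ω, ∏ z ∈ T, hopKernel u (X n ω) (X z ω) ∂P := by
  have h2 := h.measureReal_links (pathLinks n T) fun e he => by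
    rcases Finset.mem_union.1 he with he | he <;> obtain ⟨z, hz, rfl⟩ := Finset.mem_image.1 he
    · rw [Sym2.mk_isDiag_iff, Option.some.injEq]
      exact fun hnz => hT (hnz ▸ hz)
    · simp
  simp_rw [prod_pathLinks] at h2
  rw [← h2]
  congr 1
  ext ω
  simp only [pathLinks, Finset.mem_union, Finset.mem_image, Set.mem_ofPred_eq]
  constructor
  · rintro h e (⟨z, hz, rfl⟩ | ⟨z, hz, rfl⟩)
    · exact (h z hz).1
    · exact (h z hz).2
  · exact fun h z hz => ⟨h _ (Or.inl ⟨z, hz, rfl⟩), h _ (Or.inr ⟨z, hz, rfl⟩)⟩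

lemma IsRandomConnectionModel.measure_biUnion_pathEvent (h : IsRandomConnectionModel P ρ u X G)
    {n : ℕ} {R : Finset ℕ} (hR : n ∉ R) :
    P (⋃ z ∈ R, pathEvent G n z) =
      ∫⁻ ω, ENNReal.ofReal (1 - ∏ z ∈ R, (1 - hopKernel u (X n ω) (X z ω))) ∂P := by
  have hint : ∀ f : ℕ → Ω → ℝ, (∀ z, Measurable (f z)) → (∀ z ω, 0 ≤ f z ω) →
      (∀ z ω, f z ω ≤ 1) → ∀ T : Finset ℕ, Integrable (fun ω => ∏ z ∈ T, f z ω) P :=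
    fun f hf hf0 hf1 T => by
      refine (integrable_const (1 : ℝ)).mono'
        (Finset.measurable_fun_prod _ fun z _ => hf z).aestronglyMeasurable
        (ae_of_all _ fun ω => ?_)
      rw [Real.norm_of_nonneg (Finset.prod_nonneg fun z _ => hf0 z ω)]
      exact Finset.prod_le_one (fun z _ => hf0 z ω) fun z _ => hf1 z ω
  set f : ℕ → Ω → ℝ := fun z => (pathEvent G n z).indicator fun _ => 1 with hf
  have hfm : ∀ z, Measurable (f z) := fun z =>
    measurable_const.indicator (h.measurableSet_pathEvent n z)
  have hf0 : ∀ z ω, 0 ≤ f z ω := fun z ω => Set.indicator_nonneg (fun _ _ => zero_le_one) ω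
  have hf1 : ∀ z ω, f z ω ≤ 1 := fun z ω => Set.indicator_le_self' (fun _ _ => zero_le_one) ω
  have hprod : ∀ (T : Finset ℕ) ω, ∏ z ∈ T, f z ω =
      {ω | ∀ z ∈ T, ω ∈ pathEvent G n z}.indicator (fun _ => (1 : ℝ)) ω := fun T ω => by
    by_cases hω : ω ∈ {ω | ∀ z ∈ T, ω ∈ pathEvent G n z}
    · rw [Set.indicator_of_mem hω, Finset.prod_eq_one]
      exact fun z hz => Set.indicator_of_mem (hω z hz) _
    · rw [Set.indicator_of_notMem hω]
      rw [Set.mem_ofPred_eq] at hω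
      push Not at hω
      obtain ⟨z, hz, hz'⟩ := hω
      exact Finset.prod_eq_zero hz (Set.indicator_of_notMem hz' _)
  -- The path indicators and the kernels have the same mixed moments, so the probability of having
  -- no path is the mean of ∏ (1 - φ).
  have hmain := integral_prod_one_sub_congr (P := P) (R := R) (f := f)
    (g := fun z ω => hopKernel u (X n ω) (X z ω)) (fun T _ => hint f hfm hf0 hf1 T)
    (fun T _ => hint _ (h.measurable_hopKernel n) (fun _ _ => hopKernel_nonneg _ _ _)
      (fun _ _ => hopKernel_le_one _ _ _) T) fun T hT => by
      rw [← h.measureReal_paths fun hn => hR (hT hn), integral_congr_ae (ae_of_all _ (hprod T)),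
        integral_indicator]
      · simp [measureReal_def, pathEvent]
      · have : {ω | ∀ z ∈ T, ω ∈ pathEvent G n z} = ⋂ z ∈ T, pathEvent G n z := by
          ext ω
          simp
        rw [this]
        exact T.measurableSet_biInter fun z _ => h.measurableSet_pathEvent n z
  have hU : MeasurableSet (⋃ z ∈ R, pathEvent G n z) :=
    R.measurableSet_biUnion fun z _ => h.measurableSet_pathEvent n z
  have hcompl : ∀ ω, ∏ z ∈ R, (1 - f z ω) =
      1 - (⋃ z ∈ R, pathEvent G n z).indicator (fun _ => (1 : ℝ)) ω := fun ω => by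
    by_cases hω : ω ∈ ⋃ z ∈ R, pathEvent G n z
    · rw [Set.indicator_of_mem hω, sub_self]
      obtain ⟨z, hz, hz'⟩ := Set.mem_iUnion₂.1 hω
      exact Finset.prod_eq_zero hz (by rw [hf]; simp only [Set.indicator_of_mem hz', sub_self])
    · rw [Set.indicator_of_notMem hω, sub_zero]
      refine Finset.prod_eq_one fun z hz => ?_
      have : ω ∉ pathEvent G n z := fun h' => hω (Set.mem_biUnion hz h')
      simp only [hf, Set.indicator_of_notMem this, sub_zero]
  have hg1 : ∀ ω, ∏ z ∈ R, (1 - hopKernel u (X n ω) (X z ω)) ≤ 1 := fun ω =>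
    Finset.prod_le_one (fun z _ => sub_nonneg.2 (hopKernel_le_one _ _ _))
      fun z _ => sub_le_self _ (hopKernel_nonneg _ _ _)
  have hgint : Integrable (fun ω => ∏ z ∈ R, (1 - hopKernel u (X n ω) (X z ω))) P :=
    hint (fun z ω => 1 - hopKernel u (X n ω) (X z ω))
      (fun z => (h.measurable_hopKernel n z).const_sub 1)
      (fun _ _ => sub_nonneg.2 (hopKernel_le_one _ _ _))
      (fun _ _ => sub_le_self _ (hopKernel_nonneg _ _ _)) R
  have hdiff : Integrable (fun ω => 1 - ∏ z ∈ R, (1 - hopKernel u (X n ω) (X z ω))) P :=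
    (integrable_const 1).sub hgint
  rw [← ofReal_integral_eq_lintegral_ofReal hdiff
    (ae_of_all _ fun ω => sub_nonneg.2 (hg1 ω)), integral_sub (integrable_const 1) hgint, ← hmain,
    integral_congr_ae (ae_of_all _ hcompl), integral_sub (integrable_const 1)
      ((integrable_const 1).indicator hU), sub_sub_cancel, integral_indicator hU]
  simp

/-- Continuity of `P` along increasing unions on one side matches monotone convergence in `K` on the
other. -/
lemma IsRandomConnectionModel.measure_exists_path (h : IsRandomConnectionModel P ρ u X G)
    (n : ℕ) :
    P {ω | ∃ z : Option ℕ, (G ω).Adj (some n) z ∧ (G ω).Adj z none} =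
      ∫⁻ ω, neighbourProb (hopKernel u) (fun k => X k ω) n ∂P := by
  have hmono : ∀ {k l : ℕ}, k ≤ l → (Finset.range k).erase n ⊆ (Finset.range l).erase n :=
    fun hkl => Finset.erase_subset_erase _ (Finset.range_mono hkl)
  rw [setOf_exists_path, Monotone.measure_iUnion fun k l hkl =>
    Set.biUnion_subset_biUnion_left (hmono hkl)]
  unfold neighbourProb
  rw [lintegral_iSup]
  · exact iSup_congr fun K => h.measure_biUnion_pathEvent (Finset.notMem_erase n _)
  · exact fun K => ENNReal.measurable_ofReal.comp
      ((Finset.measurable_fun_prod _ fun z _ => (h.measurable_hopKernel n z).const_sub 1).const_sub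
        1)
  · exact fun k l hkl ω => ENNReal.ofReal_le_ofReal (sub_le_sub_left
      (Finset.prod_le_prod_of_subset_of_le_one (hmono hkl)
        (fun z _ => sub_nonneg.2 (hopKernel_le_one _ _ _))
        fun z _ _ => sub_le_self _ (hopKernel_nonneg _ _ _)) _)

/-- The mean number of vertices with a two-hop path to the roadside unit. -/
theorem IsRandomConnectionModel.meanTwoHopCount_eq (h : IsRandomConnectionModel P ρ u X G)
    (hρ : 0 ≤ ρ) :
    meanTwoHopCount P G = ENNReal.ofReal (ρ * gaussianCoverage (ρ * √(Real.pi / 2))) := by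
  have hpt : ∀ ω, (twoHopCount G ω : ℝ≥0∞) = ∑' n,
      {ω | ∃ z : Option ℕ, (G ω).Adj (some n) z ∧ (G ω).Adj z none}.indicator
        (fun _ => (1 : ℝ≥0∞)) ω := fun ω => by
    rw [twoHopCount, ← ENNReal.tsum_set_one, tsum_subtype _ fun _ => (1 : ℝ≥0∞)]
    rfl
  rw [meanTwoHopCount, lintegral_congr hpt, lintegral_tsum fun n =>
    (measurable_const.indicator (h.measurableSet_exists_path n)).aemeasurable]
  have hterm : ∀ n, ∫⁻ ω, {ω | ∃ z : Option ℕ, (G ω).Adj (some n) z ∧ (G ω).Adj z none}.indicator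
        (fun _ => (1 : ℝ≥0∞)) ω ∂P =
      ∫⁻ ω, neighbourProb (hopKernel u) (fun k => X k ω) n ∂P := fun n => by
    rw [lintegral_indicator_const (h.measurableSet_exists_path n), one_mul,
      h.measure_exists_path]
  simp_rw [hterm]
  rw [← lintegral_tsum fun n => (measurable_neighbourProb h.poisson.measurable
      (continuous_hopKernel u).measurable n).aemeasurable,
    h.poisson.lintegral_tsum_neighbourProb hρ (hopKernel_nonneg u) (hopKernel_le_one u)
      (continuous_hopKernel u) fun x => (lintegral_hopKernel u x).trans_ne ENNReal.ofReal_ne_top,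
    meanNeighbourIntegral_hopKernel hρ]

end Links

/-! ### Asymptotics in ρ and the main theorem. -/

lemma tendsto_meanTwoHopCount_atTop :
    Tendsto (fun ρ : ℝ => ρ * gaussianCoverage (ρ * √(Real.pi / 2)) /
      (2 * ρ * √(2 * Real.log ρ + 2 * Real.log √(Real.pi / 2)))) atTop (𝓝 1) := by
  have hs : 0 < √(Real.pi / 2) := Real.sqrt_pos.2 (by positivity)
  have h := tendsto_gaussianCoverage_div_atTop.comp (tendsto_id.atTop_mul_const hs)
  refine h.congr' ?_
  filter_upwards [eventually_gt_atTop 0] with ρ hρ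
  rw [Function.comp_apply, id, Real.log_mul hρ.ne' hs.ne', mul_add, mul_comm 2 ρ, mul_assoc ρ,
    mul_div_mul_left _ _ hρ.ne']

lemma tendsto_meanTwoHopCount_zero :
    Tendsto (fun ρ : ℝ => ρ * gaussianCoverage (ρ * √(Real.pi / 2)) / (Real.pi * ρ ^ 2))
      (𝓝[>] 0) (𝓝 1) := by
  have hs : 0 < √(Real.pi / 2) := Real.sqrt_pos.2 (by positivity)
  have hmap : Tendsto (fun ρ : ℝ => ρ * √(Real.pi / 2)) (𝓝[>] 0) (𝓝[>] 0) := by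
    refine tendsto_nhdsWithin_iff.2 ⟨?_, ?_⟩
    · have : Tendsto (fun ρ : ℝ => ρ * √(Real.pi / 2)) (𝓝 0) (𝓝 (0 * √(Real.pi / 2))) :=
        tendsto_id.mul_const _
      rw [zero_mul] at this
      exact this.mono_left nhdsWithin_le_nhds
    · filter_upwards [self_mem_nhdsWithin] with ρ hρ
      exact mul_pos hρ hs
  have h := (tendsto_gaussianCoverage_div_zero.comp hmap).mul_const (√(Real.pi / 2) / Real.pi)
  -- The constant π of the sparse regime is √(2π) · √(π/2): the slope of the coverage integral at 0
  -- times the factor relating c to ρ.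
  have hval : √(2 * Real.pi) * (√(Real.pi / 2) / Real.pi) = 1 := by
    rw [← mul_div_assoc, ← Real.sqrt_mul (by positivity),
      show 2 * Real.pi * (Real.pi / 2) = Real.pi ^ 2 by ring, Real.sqrt_sq Real.pi_pos.le,
      div_self Real.pi_pos.ne']
  rw [hval] at h
  refine h.congr' ?_
  filter_upwards [self_mem_nhdsWithin] with ρ (hρ : 0 < ρ)
  rw [Function.comp_apply]
  field_simp

theorem theorem1 (u : ℝ) :
    (∀ (ρ : ℝ), 0 < ρ → ∀ (Ω : Type*) [MeasurableSpace Ω] (P : Measure Ω)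
        [IsProbabilityMeasure P] (X : ℕ → Ω → ℝ) (G : Ω → SimpleGraph (Option ℕ)),
      IsRandomConnectionModel P ρ u X G →
        Measurable (twoHopCount G) ∧
        Integrable (fun x : ℝ =>
          1 - Real.exp (-(ρ * √(Real.pi / 2) * Real.exp (-(x - u) ^ 2 / 2)))) ∧
        meanTwoHopCount P G = ENNReal.ofReal (ρ * ∫ x : ℝ,
          (1 - Real.exp (-(ρ * √(Real.pi / 2) * Real.exp (-(x - u) ^ 2 / 2))))) ∧
        HasSum (fun k : ℕ => ρ * √(2 * Real.pi) *
            ((-1 : ℝ) ^ k * (ρ * √(Real.pi / 2)) ^ (k + 1) /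
              ((Nat.factorial (k + 1) : ℝ) * √((k + 1 : ℕ) : ℝ))))
          (ρ * ∫ x : ℝ,
            (1 - Real.exp (-(ρ * √(Real.pi / 2) * Real.exp (-(x - u) ^ 2 / 2)))))) ∧
    (∀ (Ω : ℝ → Type*) [∀ ρ, MeasurableSpace (Ω ρ)] (P : ∀ ρ, Measure (Ω ρ))
        [∀ ρ, IsProbabilityMeasure (P ρ)] (X : ∀ ρ, ℕ → Ω ρ → ℝ)
        (G : ∀ ρ, Ω ρ → SimpleGraph (Option ℕ)),
      (∀ ρ, 0 < ρ → IsRandomConnectionModel (P ρ) ρ u (X ρ) (G ρ)) →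
        Tendsto (fun ρ : ℝ => (meanTwoHopCount (P ρ) (G ρ)).toReal /
          (2 * ρ * √(2 * Real.log ρ + 2 * Real.log √(Real.pi / 2)))) atTop (𝓝 1) ∧
        Tendsto (fun ρ : ℝ => (meanTwoHopCount (P ρ) (G ρ)).toReal /
          (Real.pi * ρ ^ 2)) (𝓝[>] 0) (𝓝 1)) := by
  refine ⟨fun ρ hρ Ω _ P _ X G h => ?_, fun Ω _ P _ X G h => ?_⟩
  · have hc : 0 ≤ ρ * √(Real.pi / 2) := by positivity
    rw [integral_sub_eq_gaussianCoverage]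
    refine ⟨h.measurable_twoHopCount, (integrable_gaussianCoverage hc).comp_sub_right u,
      h.meanTwoHopCount_eq hρ.le, ?_⟩
    simpa only [mul_assoc] using (hasSum_gaussianCoverage hc).mul_left ρ
  -- The mean is finite, so `toReal` returns its true value; both limits involve only ρ > 0
  -- eventually.
  · have hmean : ∀ ρ, 0 < ρ → (meanTwoHopCount (P ρ) (G ρ)).toReal =
        ρ * gaussianCoverage (ρ * √(Real.pi / 2)) := fun ρ hρ => by
      rw [(h ρ hρ).meanTwoHopCount_eq hρ.le, ENNReal.toReal_ofReal
        (mul_nonneg hρ.le (gaussianCoverage_nonneg (by positivity)))]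
    constructor
    · refine tendsto_meanTwoHopCount_atTop.congr' ?_
      filter_upwards [eventually_gt_atTop 0] with ρ hρ
      rw [hmean ρ hρ]
    · refine tendsto_meanTwoHopCount_zero.congr' ?_
      filter_upwards [self_mem_nhdsWithin] with ρ hρ
      rw [hmean ρ hρ]
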